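/- Let $\mathbb N=\{1,2,\ldots\}$. Write $(x,y)$ for the greatest common divisor (so $(0,n)=n$), $[x_1,\ldots,x_k]$ for the least common multiple, $\varphi$ for Euler's totient function and $\tau(n)$ for the number of positive divisors of $n$. Write $p^\nu\,\|\,n$ to mean that $p$ is a prime divisor of $n$ and $p^\nu$ is the exact power of $p$ dividing $n$. Then for all $n,k\in\mathbb N$, $$\sum_{\substack{1\le a_1\le n\\ (a_1,n)=1}}\cdots\sum_{\substack{1\le a_k\le n\\ (a_k,n)=1}} [(a_1-1,n),\ldots,(a_k-1,n)] = \varphi(n)^k\prod_{p^\nu\| n}\left(1+k\nu+\sum_{j=1}^{k-1}(-1)^j\binom{k}{j+1}\frac{p^j}{(p-1)^j(p^j-1)}\left(1-\frac1{p^{\nu j}}\right)\right).$$ In particular, for every $n\in\mathbb N$, the case $k=2$ gives $$\sum_{\substack{1\le a,b\le n\\ (a,n)=(b,n)=1}}[(a-1,n),(b-1,n)]=\varphi(n)^2\prod_{p^\nu\| n}\left(1+2\nu-\frac{p^\nu-1}{p^{\nu-1}(p-1)^2}\right),$$ and the case $k=1$ gives Menon's identity $$\sum_{\substack{1\le a\le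 n\\ (a,n)=1}}(a-1,n)=\varphi(n)\,\tau(n).$$ -/

import Mathlib

/-- The reduced residues `a` modulo `n` with `1 ≤ a ≤ n` and `(a, n) = 1`. -/
def reducedResidues (n : ℕ) : Finset ℕ :=
  (Finset.Icc 1 n).filter (fun a => Nat.gcd a n = 1)

/-- The sum, over all `k`-tuples `(a₁, …, a_k)` of reduced residues modulo `n`, of the least common
multiple `[(a₁ - 1, n), …, (a_k - 1, n)]`. The difference `aᵢ - 1` is taken in `ℤ`. -/
def lcmMenonSum (n k : ℕ) : ℕ :=
  ∑ a ∈ Fintype.piFinset (fun _ : Fin k => reducedResidues n),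
    Finset.univ.lcm (fun i : Fin k => Int.gcd ((a i : ℤ) - 1) (n : ℤ))

/-! By the Chinese remainder theorem the sum is multiplicative in `n`, so `n = p ^ ν` suffices.
There the lcm `L` of a tuple is a power of `p`, and Gauss's identity writes it as the sum of
`φ(p^t)` over `p^t ∣ L`. For `1 ≤ t ≤ ν`, `p^t ∤ L` means that no entry is `1` mod `p^t`, which
leaves `(φ(n) - p^(ν-t))^k` tuples. Since `p^(ν-t) = φ(n)/x` with `x = φ(p^t)`, the sum is `φ(n)^k
(1 + ∑ x(1 - (1 - 1/x)^k))` over `1 ≤ t ≤ ν`. Binomial expansion and a geometric sum over `t` give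
the local factor. -/

/-! ### Least common multiples -/

theorem Finset.lcm_mul_of_coprime {ι : Type*} (s : Finset ι) {m n : ℕ} (hmn : m.Coprime n)
    {f g : ι → ℕ} (hf : ∀ i, f i ∣ m) (hg : ∀ i, g i ∣ n) :
    s.lcm (fun i => f i * g i) = s.lcm f * s.lcm g := by
  classical
  induction s using Finset.induction_on with
  | empty => simp
  | insert a s ha ih =>
    have hF : s.lcm f ∣ m := Finset.lcm_dvd fun i _ => hf i
    have hG : s.lcm g ∣ n := Finset.lcm_dvd fun i _ => hg i
    rw [Finset.lcm_insert, Finset.lcm_insert, Finset.lcm_insert, ih]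
    simp only [lcm_eq_nat_lcm]
    have h₁ : (f a).Coprime (g a) := hmn.of_dvd (hf a) (hg a)
    have h₂ : (s.lcm f).Coprime (s.lcm g) := hmn.of_dvd hF hG
    have h₃ : ((f a).lcm (s.lcm f)).Coprime ((g a).lcm (s.lcm g)) :=
      hmn.of_dvd (Nat.lcm_dvd (hf a) hF) (Nat.lcm_dvd (hg a) hG)
    -- Products of coprime numbers are lcms, so only a rearrangement of lcms remains.
    rw [← h₁.lcm_eq_mul, ← h₂.lcm_eq_mul, ← h₃.lcm_eq_mul, Nat.lcm_assoc, Nat.lcm_assoc,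
      ← Nat.lcm_assoc (g a), Nat.lcm_comm (g a) (s.lcm f), Nat.lcm_assoc (s.lcm f)]

theorem Nat.Prime.pow_dvd_lcm_iff {p t a b : ℕ} (hp : p.Prime) (ha : a ≠ 0) (hb : b ≠ 0) :
    p ^ t ∣ a.lcm b ↔ p ^ t ∣ a ∨ p ^ t ∣ b := by
  rw [hp.pow_dvd_iff_le_factorization (Nat.lcm_ne_zero ha hb),
    hp.pow_dvd_iff_le_factorization ha, hp.pow_dvd_iff_le_factorization hb,
    Nat.factorization_lcm ha hb]
  simp

theorem Nat.Prime.pow_dvd_finset_lcm_iff {ι : Type*} {p t : ℕ} (hp : p.Prime) (ht : t ≠ 0)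
    (s : Finset ι) {f : ι → ℕ} (hf : ∀ i, f i ≠ 0) :
    p ^ t ∣ s.lcm f ↔ ∃ i ∈ s, p ^ t ∣ f i := by
  classical
  induction s using Finset.induction_on with
  -- The empty lcm is `1`, hence the need for `t ≠ 0`.
  | empty => simp [ht, hp.ne_one]
  | insert a s ha ih =>
    have hF : s.lcm f ≠ 0 := by
      rw [Ne, Finset.lcm_eq_zero_iff]
      rintro ⟨i, -, hi⟩
      exact hf i hi
    rw [Finset.lcm_insert, lcm_eq_nat_lcm, hp.pow_dvd_lcm_iff (hf a) hF, ih]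
    simp

/-! ### Reduced residues and units -/

theorem mem_reducedResidues {n a : ℕ} :
    a ∈ reducedResidues n ↔ (1 ≤ a ∧ a ≤ n) ∧ a.Coprime n := by
  simp [reducedResidues, Nat.Coprime]

theorem card_reducedResidues (n : ℕ) : (reducedResidues n).card = n.totient := by
  rw [Nat.totient_eq_card_coprime, reducedResidues]
  -- The ranges `1..n` and `0..n-1` differ only in `n` and `0`, neither coprime to `n` once `n ≥ 2`.
  rcases Nat.lt_or_ge n 2 with h | h
  · interval_cases n <;> decide
  · congr 1
    ext a
    simp only [Finset.mem_filter, Finset.mem_Icc, Finset.mem_range]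
    constructor
    · rintro ⟨⟨h1, h2⟩, h3⟩
      refine ⟨lt_of_le_of_ne h2 ?_, Nat.coprime_comm.1 h3⟩
      rintro rfl
      simp at h3; omega
    · rintro ⟨h1, h2⟩
      refine ⟨⟨?_, h1.le⟩, Nat.coprime_comm.1 h2⟩
      rcases Nat.eq_zero_or_pos a with rfl | h
      · simp at h2; omega
      · exact h

theorem Int.gcd_sub_one_congr {n a b : ℕ} (h : a ≡ b [MOD n]) :
    Int.gcd ((a : ℤ) - 1) n = Int.gcd ((b : ℤ) - 1) n := by
  have h' : ((a : ℤ) - 1) ≡ ((b : ℤ) - 1) [ZMOD n] :=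
    ((Int.natCast_modEq_iff).2 h).sub_right 1
  obtain ⟨c, hc⟩ := h'.dvd
  rw [show (b : ℤ) - 1 = ((a : ℤ) - 1) + n * c by linarith]
  simp

theorem natCast_injOn_reducedResidues {n a b : ℕ} (ha : a ∈ reducedResidues n)
    (hb : b ∈ reducedResidues n) (h : (a : ZMod n) = b) : a = b := by
  rw [mem_reducedResidues] at ha hb
  rw [ZMod.natCast_eq_natCast_iff, Nat.modEq_iff_dvd] at h
  obtain ⟨c, hc⟩ := h
  have : (n : ℤ) > 0 := by omega
  have h1 : c < 1 := by by_contra! hh; nlinarith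
  have h2 : -1 < c := by by_contra! hh; nlinarith
  have : c = 0 := by omega
  subst this
  simp at hc; omega

theorem exists_mem_reducedResidues {n : ℕ} [NeZero n] (u : (ZMod n)ˣ) :
    ∃ a ∈ reducedResidues n, (a : ZMod n) = u := by
  have hv := ZMod.val_coe_unit_coprime u
  rcases Nat.eq_zero_or_pos (u : ZMod n).val with h0 | h0
  · refine ⟨n, mem_reducedResidues.2 ⟨⟨NeZero.one_le, le_rfl⟩, ?_⟩, ?_⟩
    · rw [h0] at hv
      have : n = 1 := by simpa using hv
      subst this; simp
    · rw [← ZMod.natCast_zmod_val (u : ZMod n), h0]; simp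
  · exact ⟨_, mem_reducedResidues.2 ⟨⟨h0, (ZMod.val_lt _).le⟩, hv⟩, ZMod.natCast_zmod_val _⟩

theorem sum_piFinset_reducedResidues {M : Type*} [AddCommMonoid M] (n : ℕ) [NeZero n] (k : ℕ)
    (F : (Fin k → ZMod n) → M) :
    ∑ a ∈ Fintype.piFinset (fun _ : Fin k => reducedResidues n), F (fun i => (a i : ZMod n)) =
      ∑ u : Fin k → (ZMod n)ˣ, F (fun i => (u i : ZMod n)) := by
  refine Finset.sum_bij (fun a ha i => ZMod.unitOfCoprime (a i)
    (mem_reducedResidues.1 (Fintype.mem_piFinset.1 ha i)).2) (fun _ _ => Finset.mem_univ _) ?_ ?_ ?_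
  · intro a ha b hb h
    funext i
    refine natCast_injOn_reducedResidues (Fintype.mem_piFinset.1 ha i)
      (Fintype.mem_piFinset.1 hb i) ?_
    simpa using congrArg Units.val (congrFun h i)
  · intro u _
    choose a ha hu using fun i => exists_mem_reducedResidues (u i)
    exact ⟨a, Fintype.mem_piFinset.2 ha, funext fun i => Units.ext (by simpa using hu i)⟩
  · intro a ha
    simp

/-! ### Multiplicativity -/

/-- The greatest common divisor of `x - 1` and `n`, for a residue class `x` modulo `n`. -/
def gcdSubOne (n : ℕ) (x : ZMod n) : ℕ :=
  Int.gcd ((x.val : ℤ) - 1) n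

theorem gcdSubOne_natCast (n a : ℕ) : gcdSubOne n (a : ZMod n) = Int.gcd ((a : ℤ) - 1) n := by
  rw [gcdSubOne, ZMod.val_natCast]
  exact Int.gcd_sub_one_congr (Nat.mod_modEq a n)

theorem gcdSubOne_dvd (n : ℕ) (x : ZMod n) : gcdSubOne n x ∣ n := by
  simpa [gcdSubOne] using Int.gcd_dvd_natAbs_right ((x.val : ℤ) - 1) n

theorem gcdSubOne_mul {m n : ℕ} (hmn : m.Coprime n) (hm : m ≠ 0) (hn : n ≠ 0)
    (x : ZMod (m * n)) :
    gcdSubOne (m * n) x =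
      gcdSubOne m (ZMod.chineseRemainder hmn x).1 * gcdSubOne n (ZMod.chineseRemainder hmn x).2 := by
  have : NeZero (m * n) := ⟨mul_ne_zero hm hn⟩
  obtain ⟨a, rfl⟩ : ∃ a : ℕ, (a : ZMod (m * n)) = x := ⟨x.val, ZMod.natCast_zmod_val x⟩
  rw [map_natCast, Prod.fst_natCast, Prod.snd_natCast]
  simp only [gcdSubOne_natCast]
  simp only [Int.gcd, Int.natAbs_natCast]
  exact hmn.gcd_mul _

theorem lcmMenonSum_eq_sum_units (n : ℕ) [NeZero n] (k : ℕ) :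
    lcmMenonSum n k =
      ∑ u : Fin k → (ZMod n)ˣ, Finset.univ.lcm (fun i => gcdSubOne n (u i : ZMod n)) := by
  rw [← sum_piFinset_reducedResidues n k (fun x => Finset.univ.lcm fun i => gcdSubOne n (x i))]
  simp only [gcdSubOne_natCast, lcmMenonSum]

theorem lcmMenonSum_mul {m n : ℕ} (hmn : m.Coprime n) (hm : m ≠ 0) (hn : n ≠ 0) (k : ℕ) :
    lcmMenonSum (m * n) k = lcmMenonSum m k * lcmMenonSum n k := by
  have : NeZero m := ⟨hm⟩
  have : NeZero n := ⟨hn⟩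
  rw [lcmMenonSum_eq_sum_units, lcmMenonSum_eq_sum_units, lcmMenonSum_eq_sum_units,
    Finset.sum_mul_sum, ← Fintype.sum_prod_type']
  let e : (ZMod (m * n))ˣ ≃ (ZMod m)ˣ × (ZMod n)ˣ :=
    ((Units.mapEquiv (ZMod.chineseRemainder hmn).toMulEquiv).trans MulEquiv.prodUnits).toEquiv
  refine Fintype.sum_equiv ((Equiv.arrowCongr (Equiv.refl (Fin k)) e).trans
    (Equiv.arrowProdEquivProdArrow _ _ _)) _ _ fun u => ?_
  rw [← Finset.lcm_mul_of_coprime _ hmn (fun i => gcdSubOne_dvd m _)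
    (fun i => gcdSubOne_dvd n _)]
  congr 1
  funext i
  exact gcdSubOne_mul hmn hm hn _

/-! ### Prime powers -/

/-- These residues are `p^t c + 1` with `c < p^(ν-t)`; as `t ≥ 1`, they are automatically prime to
`p`. -/
theorem card_filter_reducedResidues_prime_pow {p ν t : ℕ} (hp : p.Prime) (ht : t ≠ 0)
    (htν : t ≤ ν) :
    ((reducedResidues (p ^ ν)).filter
      (fun a : ℕ => p ^ t ∣ Int.gcd ((a : ℤ) - 1) ((p ^ ν : ℕ) : ℤ))).card = p ^ (ν - t) := by
  have hpt : 0 < p ^ t := pow_pos hp.pos _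
  have hpow : p ^ ν = p ^ t * p ^ (ν - t) := by rw [← pow_add]; congr 1; omega
  have hdvd : p ^ t ∣ p ^ ν := pow_dvd_pow p htν
  have key : (reducedResidues (p ^ ν)).filter
      (fun a : ℕ => p ^ t ∣ Int.gcd ((a : ℤ) - 1) ((p ^ ν : ℕ) : ℤ)) =
      (Finset.range (p ^ (ν - t))).image (fun c => p ^ t * c + 1) := by
    ext a
    simp only [Finset.mem_filter, mem_reducedResidues, Finset.mem_image, Finset.mem_range]
    constructor
    · rintro ⟨⟨⟨h1, h2⟩, -⟩, h3⟩
      obtain ⟨b, rfl⟩ : ∃ b, a = b + 1 := ⟨a - 1, by omega⟩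
      have h4 : p ^ t ∣ b := by
        rw [← Int.natCast_dvd_natCast]
        simpa using (Int.natCast_dvd_natCast.2 h3).trans (Int.gcd_dvd_left _ _)
      obtain ⟨c, rfl⟩ := h4
      refine ⟨c, ?_, rfl⟩
      rw [hpow] at h2
      exact lt_of_mul_lt_mul_left (by omega : p ^ t * c < p ^ t * p ^ (ν - t)) (Nat.zero_le _)
    · rintro ⟨c, hc, rfl⟩
      refine ⟨⟨⟨by omega, ?_⟩, ?_⟩, ?_⟩
      · rw [hpow]
        have := Nat.mul_lt_mul_of_pos_left hc hpt
        omega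
      · refine Nat.Coprime.pow_right _ ?_
        obtain ⟨s, rfl⟩ := Nat.exists_eq_succ_of_ne_zero ht
        rw [Nat.succ_eq_add_one, pow_succ', mul_assoc]
        simp
      · rw [← Int.natCast_dvd_natCast]
        exact Int.dvd_coe_gcd (by simp) (Int.natCast_dvd_natCast.2 hdvd)
  rw [key, Finset.card_image_of_injective, Finset.card_range]
  intro a b h
  simpa [hp.ne_zero] using h

theorem lcmMenonSum_prime_pow {p ν : ℕ} (hp : p.Prime) (k : ℕ) :
    (lcmMenonSum (p ^ ν) k : ℚ) = ((p ^ ν).totient : ℚ) ^ k +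
      ∑ t ∈ Finset.range ν, ((p ^ (t + 1)).totient : ℚ) *
        (((p ^ ν).totient : ℚ) ^ k -
          (((p ^ ν).totient : ℚ) - (p : ℚ) ^ (ν - (t + 1))) ^ k) := by
  set n := p ^ ν with hn
  have hn0 : n ≠ 0 := pow_ne_zero _ hp.ne_zero
  set A := Fintype.piFinset (fun _ : Fin k => reducedResidues n) with hA
  set L : (Fin k → ℕ) → ℕ :=
    fun a => Finset.univ.lcm (fun i : Fin k => Int.gcd ((a i : ℤ) - 1) (n : ℤ)) with hL
  have hcardA : A.card = n.totient ^ k := by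
    simp [hA, Fintype.card_piFinset, card_reducedResidues]
  have hLdvd : ∀ a, L a ∣ n := fun a => Finset.lcm_dvd fun i _ => by
    simpa using Int.gcd_dvd_natAbs_right ((a i : ℤ) - 1) n
  -- Gauss's identity for the totient, applied to the power of `p` equal to `L a`.
  have hsum : ∀ a, L a = ∑ t ∈ Finset.range (ν + 1),
      if p ^ t ∣ L a then (p ^ t).totient else 0 := by
    intro a
    obtain ⟨s, hs, hLs⟩ := (Nat.dvd_prime_pow hp).1 (hLdvd a)
    rw [hLs, ← Finset.sum_filter]
    conv_lhs => rw [← Nat.sum_totient (p ^ s), Nat.sum_divisors_prime_pow hp]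
    refine Finset.sum_congr ?_ fun _ _ => rfl
    ext t
    simp only [Finset.mem_range, Finset.mem_filter, Nat.pow_dvd_pow_iff_le_right hp.one_lt]
    omega
  have hcount : ∀ t ∈ Finset.range ν, ((A.filter (fun a => p ^ (t + 1) ∣ L a)).card : ℚ) =
      (n.totient : ℚ) ^ k - ((n.totient : ℚ) - (p : ℚ) ^ (ν - (t + 1))) ^ k := by
    intro t ht
    have htν : t + 1 ≤ ν := Finset.mem_range.1 ht
    set B := (reducedResidues n).filter
      (fun a : ℕ => p ^ (t + 1) ∣ Int.gcd ((a : ℤ) - 1) (n : ℤ)) with hB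
    have hBcard : B.card = p ^ (ν - (t + 1)) :=
      card_filter_reducedResidues_prime_pow hp t.succ_ne_zero htν
    -- The complement is easier to count: the condition splits over the coordinates.
    have hcompl : A.filter (fun a => ¬ p ^ (t + 1) ∣ L a) =
        Fintype.piFinset (fun _ : Fin k => reducedResidues n \ B) := by
      ext a
      have : p ^ (t + 1) ∣ L a ↔ ∃ i, p ^ (t + 1) ∣ Int.gcd ((a i : ℤ) - 1) (n : ℤ) := by
        rw [hL]
        simpa using hp.pow_dvd_finset_lcm_iff t.succ_ne_zero Finset.univ
          (f := fun i : Fin k => Int.gcd ((a i : ℤ) - 1) (n : ℤ))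
          (fun i => by rw [Ne, Int.gcd_eq_zero_iff]; rintro ⟨-, h⟩; exact hn0 (by exact_mod_cast h))
      simp only [Finset.mem_filter, this, hA, Fintype.mem_piFinset, hB, Finset.mem_sdiff]
      push Not
      constructor
      · rintro ⟨h1, h2⟩ i
        exact ⟨h1 i, fun _ => h2 i⟩
      · intro h
        exact ⟨fun i => (h i).1, fun i => (h i).2 (h i).1⟩
    have hsd : ((reducedResidues n \ B).card : ℚ) =
        (n.totient : ℚ) - (p : ℚ) ^ (ν - (t + 1)) := by
      have := Finset.card_sdiff_add_card_eq_card (Finset.filter_subset _ _ : B ⊆ reducedResidues n)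
      rw [hBcard, card_reducedResidues] at this
      rw [← this]; push_cast; ring
    have hadd := Finset.card_filter_add_card_filter_not (s := A) (fun a => p ^ (t + 1) ∣ L a)
    rw [hcompl, hcardA, Fintype.card_piFinset] at hadd
    have hadd' := congrArg (Nat.cast : ℕ → ℚ) hadd
    push_cast [Finset.prod_const, hsd] at hadd'
    simp at hadd'
    linarith
  have hexp : lcmMenonSum n k = ∑ t ∈ Finset.range (ν + 1),
      (p ^ t).totient * (A.filter (fun a => p ^ t ∣ L a)).card := by
    change ∑ a ∈ A, L a = _
    rw [Finset.sum_congr rfl fun a _ => hsum a, Finset.sum_comm]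
    refine Finset.sum_congr rfl fun t _ => ?_
    rw [← Finset.sum_filter, Finset.sum_const, smul_eq_mul, mul_comm]
  rw [hexp, Finset.sum_range_succ']
  push_cast
  rw [Finset.sum_congr rfl fun t ht => by rw [hcount t ht]]
  simp [hcardA, add_comm]

/-- The factor of the sum of least common multiples at a prime `p` of exact exponent `ν`. -/
def localFactor (k p ν : ℕ) : ℚ :=
  1 + (k : ℚ) * (ν : ℚ) +
    ∑ j ∈ Finset.Icc 1 (k - 1),
      (-1 : ℚ) ^ j * (Nat.choose k (j + 1) : ℚ) *
        ((p : ℚ) ^ j / (((p : ℚ) - 1) ^ j * ((p : ℚ) ^ j - 1))) *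
        (1 - 1 / (p : ℚ) ^ (ν * j))

/-- In the binomial expansion the constant term cancels the `1` and the linear term gives `k`; the
power `j + 1` of `x⁻¹` loses one factor to `x`. -/
theorem mul_one_sub_one_sub_inv_pow {x : ℚ} (hx : x ≠ 0) {k : ℕ} (hk : 1 ≤ k) :
    x * (1 - (1 - x⁻¹) ^ k) =
      k + ∑ j ∈ Finset.Icc 1 (k - 1), (-1 : ℚ) ^ j * (k.choose (j + 1) : ℚ) * (x⁻¹) ^ j := by
  obtain ⟨k, rfl⟩ := Nat.exists_eq_add_of_le' hk
  have hshift : ∑ j ∈ Finset.Icc 1 k, (-1 : ℚ) ^ j * ((k + 1).choose (j + 1) : ℚ) * (x⁻¹) ^ j =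
      ∑ j ∈ Finset.range k,
        (-1 : ℚ) ^ (j + 1) * ((k + 1).choose (j + 1 + 1) : ℚ) * (x⁻¹) ^ (j + 1) := by
    rw [Finset.range_eq_Ico, Finset.sum_Ico_add'
      (fun j => (-1 : ℚ) ^ j * ((k + 1).choose (j + 1) : ℚ) * (x⁻¹) ^ j) 0 k 1]
    rfl
  rw [show 1 - x⁻¹ = -x⁻¹ + 1 by ring, add_pow, Finset.sum_range_succ', Finset.sum_range_succ',
    Nat.add_sub_cancel, hshift]
  have hterm : ∀ j, (-1 : ℚ) ^ (j + 1) * ((k + 1).choose (j + 1 + 1) : ℚ) * (x⁻¹) ^ (j + 1) =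
      -x * ((-x⁻¹) ^ (j + 1 + 1) * 1 ^ (k + 1 - (j + 1 + 1)) *
        ((k + 1).choose (j + 1 + 1) : ℚ)) := by
    intro j
    rw [neg_pow x⁻¹, pow_succ (x⁻¹) (j + 1), one_pow, pow_succ (-1 : ℚ) (j + 1)]
    field_simp
  rw [Finset.sum_congr rfl fun j _ => hterm j, ← Finset.mul_sum]
  simp
  field_simp

theorem sum_inv_pow {p : ℕ} (hp : 2 ≤ p) (ν : ℕ) {j : ℕ} (hj : 1 ≤ j) :
    ∑ t ∈ Finset.range ν, (((p : ℚ) ^ t * ((p : ℚ) - 1))⁻¹) ^ j =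
      ((p : ℚ) ^ j / (((p : ℚ) - 1) ^ j * ((p : ℚ) ^ j - 1))) * (1 - 1 / (p : ℚ) ^ (ν * j)) := by
  have hp' : (2 : ℚ) ≤ p := by exact_mod_cast hp
  have h1 : (p : ℚ) - 1 ≠ 0 := by linarith
  have h2 : (p : ℚ) ^ j - 1 ≠ 0 := by
    have := one_lt_pow₀ (by linarith : (1 : ℚ) < p) (by omega : j ≠ 0)
    linarith
  have h3 : (p : ℚ) ≠ 0 := by linarith
  induction ν with
  | zero => simp
  | succ ν ih =>
    rw [Finset.sum_range_succ, ih, inv_pow, mul_pow, ← pow_mul, add_mul, one_mul, pow_add]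
    field_simp
    ring

theorem lcmMenonSum_prime_pow_eq_localFactor {p ν k : ℕ} (hp : p.Prime) (hk : 1 ≤ k) :
    (lcmMenonSum (p ^ ν) k : ℚ) = ((p ^ ν).totient : ℚ) ^ k * localFactor k p ν := by
  have hp' : (2 : ℚ) ≤ p := by exact_mod_cast hp.two_le
  have h3 : (p : ℚ) ≠ 0 := by linarith
  have h1 : (p : ℚ) - 1 ≠ 0 := by linarith
  have hfac : localFactor k p ν = 1 + ∑ t ∈ Finset.range ν, ((p : ℚ) ^ t * ((p : ℚ) - 1)) *
      (1 - (1 - ((p : ℚ) ^ t * ((p : ℚ) - 1))⁻¹) ^ k) := by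
    rw [Finset.sum_congr rfl fun t _ =>
      mul_one_sub_one_sub_inv_pow (mul_ne_zero (pow_ne_zero t h3) h1) hk,
      Finset.sum_add_distrib, Finset.sum_comm, localFactor]
    rw [Finset.sum_const, Finset.card_range, nsmul_eq_mul, mul_comm (k : ℚ), add_assoc]
    congr 2
    refine Finset.sum_congr rfl fun j hj => ?_
    rw [← Finset.mul_sum, sum_inv_pow hp.two_le ν (Finset.mem_Icc.1 hj).1]
    ring
  rw [lcmMenonSum_prime_pow hp, hfac, mul_add, mul_one, Finset.mul_sum]
  congr 1
  refine Finset.sum_congr rfl fun t ht => ?_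
  have htν := Finset.mem_range.1 ht
  have hφ : ((p ^ (t + 1)).totient : ℚ) = (p : ℚ) ^ t * ((p : ℚ) - 1) := by
    rw [Nat.totient_prime_pow_succ hp]
    push_cast [hp.one_le]
    ring
  -- This lets `φ(p^ν)^k` factor out of each summand.
  have hφν : (p : ℚ) ^ (ν - (t + 1)) =
      ((p ^ ν).totient : ℚ) * ((p : ℚ) ^ t * ((p : ℚ) - 1))⁻¹ := by
    obtain ⟨d, rfl⟩ : ∃ d, ν = t + d + 1 := ⟨ν - t - 1, by omega⟩
    rw [Nat.totient_prime_pow_succ hp, show t + d + 1 - (t + 1) = d by omega]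
    push_cast [hp.one_le]
    field_simp
    ring
  rw [hφ, hφν, ← mul_one_sub, mul_pow]
  ring

/-! ### General `n` and the cases `k = 1, 2` -/

theorem lcmMenonSum_eq {n k : ℕ} (hn : n ≠ 0) (hk : 1 ≤ k) :
    (lcmMenonSum n k : ℚ) =
      (n.totient : ℚ) ^ k * ∏ p ∈ n.primeFactors, localFactor k p (n.factorization p) := by
  induction n using Nat.recOnPosPrimePosCoprime with
  | zero => exact absurd rfl hn
  | one =>
    -- Here `1` is read as `2 ^ 0`.
    have := lcmMenonSum_prime_pow_eq_localFactor (ν := 0) Nat.prime_two hk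
    simpa [localFactor] using this
  | prime_pow p ν hp hν =>
    rw [Nat.primeFactors_prime_pow hν.ne' hp, Finset.prod_singleton,
      lcmMenonSum_prime_pow_eq_localFactor hp hk, hp.factorization_pow, Finsupp.single_eq_same]
  | coprime a b ha hb hab iha ihb =>
    have ha0 : a ≠ 0 := by omega
    have hb0 : b ≠ 0 := by omega
    rw [lcmMenonSum_mul hab ha0 hb0, Nat.cast_mul, iha ha0, ihb hb0, Nat.totient_mul hab,
      hab.primeFactors_mul, Finset.prod_union hab.disjoint_primeFactors]
    have hl : ∏ p ∈ a.primeFactors, localFactor k p ((a * b).factorization p) =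
        ∏ p ∈ a.primeFactors, localFactor k p (a.factorization p) :=
      Finset.prod_congr rfl fun p hp => by
        rw [Nat.factorization_eq_of_coprime_left hab (by simpa using hp)]
    have hr : ∏ p ∈ b.primeFactors, localFactor k p ((a * b).factorization p) =
        ∏ p ∈ b.primeFactors, localFactor k p (b.factorization p) :=
      Finset.prod_congr rfl fun p hp => by
        rw [Nat.factorization_eq_of_coprime_right hab (by simpa using hp)]
    rw [hl, hr]
    push_cast
    ring

theorem lcmMenonSum_one (n : ℕ) :
    lcmMenonSum n 1 = ∑ a ∈ reducedResidues n, Int.gcd ((a : ℤ) - 1) (n : ℤ) := by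
  refine Finset.sum_nbij' (fun a => a 0) (fun a _ => a) ?_ ?_ ?_ ?_ ?_
  · intro a ha; exact Fintype.mem_piFinset.1 ha 0
  · intro a ha; exact Fintype.mem_piFinset.2 fun _ => ha
  · intro a _; funext i; rw [Subsingleton.elim i 0]
  · intro a _; rfl
  · intro a _; simp

theorem lcmMenonSum_two (n : ℕ) :
    lcmMenonSum n 2 = ∑ a ∈ reducedResidues n, ∑ b ∈ reducedResidues n,
      Nat.lcm (Int.gcd ((a : ℤ) - 1) (n : ℤ)) (Int.gcd ((b : ℤ) - 1) (n : ℤ)) := by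
  rw [← Finset.sum_product']
  refine Finset.sum_nbij' (fun a => (a 0, a 1)) (fun x => ![x.1, x.2]) ?_ ?_ ?_ ?_ ?_
  · intro a ha
    exact Finset.mem_product.2 ⟨Fintype.mem_piFinset.1 ha 0, Fintype.mem_piFinset.1 ha 1⟩
  · intro x hx
    rw [Finset.mem_product] at hx
    refine Fintype.mem_piFinset.2 fun i => ?_
    fin_cases i
    exacts [hx.1, hx.2]
  · intro a _; funext i; fin_cases i <;> rfl
  · intro x _; rfl
  · intro a _
    have : (Finset.univ : Finset (Fin 2)) = {0, 1} := rfl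
    rw [this, Finset.lcm_insert, Finset.lcm_singleton]
    simp [lcm_eq_nat_lcm]

theorem localFactor_two {p ν : ℕ} (hp : p.Prime) (hν : ν ≠ 0) :
    localFactor 2 p ν =
      1 + 2 * (ν : ℚ) - ((p : ℚ) ^ ν - 1) / ((p : ℚ) ^ (ν - 1) * ((p : ℚ) - 1) ^ 2) := by
  have hp' : (2 : ℚ) ≤ p := by exact_mod_cast hp.two_le
  have h3 : (p : ℚ) ≠ 0 := by linarith
  have h1 : (p : ℚ) - 1 ≠ 0 := by linarith
  obtain ⟨m, rfl⟩ := Nat.exists_eq_succ_of_ne_zero hν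
  simp [localFactor]
  field_simp
  ring

theorem corollary4p2 (n : ℕ) (hn : 1 ≤ n) :
    (∀ k : ℕ, 1 ≤ k →
      (lcmMenonSum n k : ℚ) =
        (Nat.totient n : ℚ) ^ k *
          ∏ p ∈ n.primeFactors,
            (1 + (k : ℚ) * (n.factorization p : ℚ) +
              ∑ j ∈ Finset.Icc 1 (k - 1),
                (-1 : ℚ) ^ j * (Nat.choose k (j + 1) : ℚ) *
                  ((p : ℚ) ^ j / (((p : ℚ) - 1) ^ j * ((p : ℚ) ^ j - 1))) *
                  (1 - 1 / (p : ℚ) ^ (n.factorization p * j)))) ∧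
    ((∑ a ∈ reducedResidues n, ∑ b ∈ reducedResidues n,
        (Nat.lcm (Int.gcd ((a : ℤ) - 1) (n : ℤ)) (Int.gcd ((b : ℤ) - 1) (n : ℤ)) : ℚ)) =
      (Nat.totient n : ℚ) ^ 2 *
        ∏ p ∈ n.primeFactors,
          (1 + 2 * (n.factorization p : ℚ) -
            ((p : ℚ) ^ n.factorization p - 1) /
              ((p : ℚ) ^ (n.factorization p - 1) * ((p : ℚ) - 1) ^ 2))) ∧
    (∑ a ∈ reducedResidues n, Int.gcd ((a : ℤ) - 1) (n : ℤ) =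
      Nat.totient n * n.divisors.card) := by
  have hn0 : n ≠ 0 := by omega
  refine ⟨fun k hk => lcmMenonSum_eq hn0 hk, ?_, ?_⟩
  · have h := lcmMenonSum_eq (k := 2) hn0 (by norm_num)
    rw [lcmMenonSum_two] at h
    push_cast at h
    rw [h]
    congr 1
    refine Finset.prod_congr rfl fun p hp => localFactor_two (Nat.prime_of_mem_primeFactors hp) ?_
    exact ((Nat.prime_of_mem_primeFactors hp).factorization_pos_of_dvd hn0
      (Nat.dvd_of_mem_primeFactors hp)).ne'
  · have h := lcmMenonSum_eq (k := 1) hn0 le_rfl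
    rw [lcmMenonSum_one] at h
    rw [Nat.card_divisors hn0]
    have h' : ∏ p ∈ n.primeFactors, localFactor 1 p (n.factorization p) =
        ((∏ p ∈ n.primeFactors, (n.factorization p + 1) : ℕ) : ℚ) := by
      push_cast
      exact Finset.prod_congr rfl fun p _ => by simp [localFactor, add_comm]
    rw [h', pow_one] at h
    exact_mod_cast h
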